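/- A real-time deterministic push-down automaton (DPDA) is a tuple $M=(Q,\Sigma,\Gamma,\delta,q_0,\bot,F)$ with finite sets $Q$ (states), $\Sigma$ (input alphabet), $\Gamma$ (stack alphabet), a total transition function $\delta:Q\times\Sigma\times\Gamma\to Q\times\Gamma^*$ (there are no $\epsilon$-transitions), an initial state $q_0\in Q$, a bottom symbol $\bot\in\Gamma$ and a set $F\subseteq Q$ of final states, such that whenever $\delta(q,a,x)=(q',\gamma)$ and $\bot$ occurs in $\gamma$, then $x=\bot$ and $\bot$ occurs in $\gamma$ only as its first letter. A configuration is a pair $(q,\upsilon)\in Q\times\Gamma^*$, where the top of the stack is the right end of $\upsilon$; reading $a\in\Sigma$ takes $(q,\upsilon x)$ to $(q',\upsilon\gamma)$ if $\delta(q,a,x)=(q',\gamma)$, and no step is possible from an empty stack. The language $\mathcal L(M)$ consists of all $w\in\Sigma^*$ that take $(q_0,\bot)$ to some $(q_f,\gamma)$ with $q_f\in F$ and $\gamma\in\Gamma^*$ arbitrary. A sequence of configurations is a stroke if none of its transitions decreases the stack height (upstroke) or none of them increases it (downstroke). $M$ is 1-turn if for every $w\in\mathcal L(M)$ the sequence of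 configurations induced by $w$ from $(q_0,\bot)$ can be split into at most two strokes. **Theorem.** The following two problems, whose instances are pairs of real-time 1-turn DPDAs $M_1,M_2$ over a common input alphabet (given by their transition tables), are undecidable: (1) Is $\mathcal L(M_1)\cap\mathcal L(M_2)=\emptyset$? (2) Is $\mathcal L(M_1)\subseteq\mathcal L(M_2)$? That is, for neither problem is there an algorithm that halts with the correct answer on every such pair. -/

import Mathlib

/-- A real-time deterministic push-down automaton `(Q, A, Γ, δ, q₀, ⊥, F)` with input alphabet `A`
and total transition function `δ` (no `ε`-transitions). Words over `Γ` are written from the bottom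
to the top of the stack. The symbol `⊥` may occur in a pushed word only as its first letter, and
only if the symbol that is replaced is `⊥`. -/
structure DPDA (Q A Γ : Type) where
  δ : Q → A → Γ → Q × List Γ
  start : Q
  bot : Γ
  final : Finset Q
  bot_rule : ∀ q a x, bot ∈ (δ q a x).2 →
    x = bot ∧ ∃ γ : List Γ, (δ q a x).2 = bot :: γ ∧ bot ∉ γ

namespace DPDA

variable {Q A Γ : Type}

/-- One step reading the letter `a`, on configurations (state, stack content); the top of the stack
is the right end of the list. There is no step from an empty stack. -/
def Step (M : DPDA Q A Γ) (a : A) (c c' : Q × List Γ) : Prop :=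
  ∃ (υ : List Γ) (x : Γ), c.2 = υ ++ [x] ∧
    c' = ((M.δ c.1 a x).1, υ ++ (M.δ c.1 a x).2)

/-- `ρ 0, …, ρ |w|` is the sequence of configurations induced by `w` from `(q₀, ⊥)`; the values of
`ρ` beyond `|w|` play no role. -/
def IsRun (M : DPDA Q A Γ) (w : List A) (ρ : ℕ → Q × List Γ) : Prop :=
  ρ 0 = (M.start, [M.bot]) ∧
    ∀ (i : ℕ) (hi : i < w.length), M.Step w[i] (ρ i) (ρ (i + 1))

/-- The accepted language: acceptance by final state, with arbitrary stack content. -/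
def language (M : DPDA Q A Γ) : Language A :=
  {w | ∃ ρ, M.IsRun w ρ ∧ (ρ w.length).1 ∈ M.final}

/-- Between the times `s` and `t` no transition decreases the stack height. -/
def IsUpstroke (ρ : ℕ → Q × List Γ) (s t : ℕ) : Prop :=
  ∀ i, s ≤ i → i < t → (ρ i).2.length ≤ (ρ (i + 1)).2.length

/-- Between the times `s` and `t` no transition increases the stack height. -/
def IsDownstroke (ρ : ℕ → Q × List Γ) (s t : ℕ) : Prop :=
  ∀ i, s ≤ i → i < t → (ρ (i + 1)).2.length ≤ (ρ i).2.length

/-- The sequence `ρ 0, …, ρ m` splits into at most `k` strokes, at the times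
`0 = t 0 ≤ t 1 ≤ … ≤ t k = m`. -/
def SplitsIntoStrokes (ρ : ℕ → Q × List Γ) (m k : ℕ) : Prop :=
  ∃ t : ℕ → ℕ, Monotone t ∧ t 0 = 0 ∧ t k = m ∧
    ∀ j < k, IsUpstroke ρ (t j) (t (j + 1)) ∨ IsDownstroke ρ (t j) (t (j + 1))

/-- An `n`-turn automaton: the run on every accepted word splits into at most `n + 1` strokes. -/
def IsNTurn (M : DPDA Q A Γ) (n : ℕ) : Prop :=
  ∀ w ∈ M.language, ∀ ρ, M.IsRun w ρ → SplitsIntoStrokes ρ w.length (n + 1)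

/-- Finite descriptions of automata, in the order `(Q, A, Γ, δ, q₀, ⊥, F)`: three cardinalities,
the table of `δ`, two indices, and the characteristic sequence of `F`. -/
abbrev Code : Type :=
  ℕ × ℕ × ℕ × List (List (List (ℕ × List ℕ))) × ℕ × ℕ × List Bool

/-- The description of an automaton whose states, letters and stack symbols are numbered. -/
def encode {q s g : ℕ} (M : DPDA (Fin q) (Fin s) (Fin g)) : Code :=
  (q, s, g,
    (List.finRange q).map (fun p => (List.finRange s).map (fun a => (List.finRange g).map
      (fun x => (((M.δ p a x).1 : ℕ), (M.δ p a x).2.map (fun y => (y : ℕ)))))),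
    (M.start : ℕ), (M.bot : ℕ),
    (List.finRange q).map (fun p => decide (p ∈ M.final)))

end DPDA

/-- A pair of real-time 1-turn deterministic push-down automata over a common input alphabet. Up to
renaming of states and symbols, every such pair of finite automata is of this form. -/
structure OneTurnPair where
  (letters states₁ states₂ stack₁ stack₂ : ℕ)
  M₁ : DPDA (Fin states₁) (Fin letters) (Fin stack₁)
  M₂ : DPDA (Fin states₂) (Fin letters) (Fin stack₂)
  oneTurn₁ : M₁.IsNTurn 1
  oneTurn₂ : M₂.IsNTurn 1

/-- The description of a pair of automata that an algorithm receives as its input. -/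
def OneTurnPair.encode (I : OneTurnPair) : DPDA.Code × DPDA.Code :=
  (I.M₁.encode, I.M₂.encode)

/-- The problem `P` on the instances `ι`, given by the encoding `enc`, is decidable: some algorithm
halts with the correct answer on the encoding of every instance. Nothing is asked of it on inputs
that encode no instance. -/
def DecidableProblem {ι α : Type} [Primcodable α] (enc : ι → α) (P : ι → Prop) : Prop :=
  ∃ f : α →. Bool, Partrec f ∧ ∀ i : ι, ∃ b : Bool, b ∈ f (enc i) ∧ (b = true ↔ P i)

/-!
A queue machine removes the first letter of its queue, and appends a word that depends on this
letter and on its finite control. If it starts with the queue `u` and halts after it has removed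
the word `z`, then `z = u ++ out z`, where `out z` consists of all that it has appended while
reading `z`; conversely every solution of this equation describes a halting computation. The halting
of programs on an input `n` thus becomes the solvability of `z = u ++ out z` for a fixed finite
transducer and a word `u` that is computed from `n`, because one passage through a queue that
contains a shuffle of several stacks can simulate one instruction of a machine with these stacks.

One automaton accepts the words `z # reverse (u ++ out z) #`, and another one the words
`z # reverse z #`. Each pushes during the first part of its input and pops during the second, so
both are 1-turn, and they accept a common word if and only if the program halts. No run gets stuck,
because the bottom symbol is never removed, so complementing the final states of the first automaton
turns disjointness into inclusion.
-/

open StateTransition Turing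

theorem DecidableProblem.computablePred {ι α β : Type} [Primcodable α] [Primcodable β]
    {enc : ι → α} {P : ι → Prop} (hP : DecidableProblem enc P) {I : β → ι}
    (hI : Computable fun n => enc (I n)) : ComputablePred fun n => P (I n) := by
  obtain ⟨f, hf, hd⟩ := hP
  choose answer hanswer hP using fun n => hd (I n)
  have hcomp : Computable answer := (hf.comp hI).of_eq fun n => Part.eq_some_iff.2 (hanswer n)
  exact ComputablePred.computable_iff.2 ⟨answer, hcomp, funext fun n => propext (hP n).symm⟩

theorem exists_code_not_computablePred_dom :
    ∃ c : ToPartrec.Code, ¬ ComputablePred fun n : ℕ => (c.eval [n]).Dom := by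
  have hf : Partrec fun n : ℕ => (Denumerable.ofNat Nat.Partrec.Code n).eval 0 :=
    Nat.Partrec.Code.eval_part.comp (Computable.ofNat _) (.const 0)
  obtain ⟨c, hc⟩ := ToPartrec.Code.exists_code (Nat.Partrec'.part_iff₁.2 hf)
  have hdom (n : ℕ) :
      (c.eval [n]).Dom ↔ ((Denumerable.ofNat Nat.Partrec.Code n).eval 0).Dom := by
    have := hc ⟨[n], rfl⟩
    rw [this]
    simp [List.Vector.head]
  refine ⟨c, fun h => ComputablePred.halting_problem 0 ?_⟩
  refine ComputablePred.computable_of_manyOneReducible ⟨_, Computable.encode, fun d => ?_⟩ h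
  rw [hdom, Denumerable.ofNat_encode]

theorem primrec_list_map_of_forall {α β γ : Type} [Primcodable α] [Primcodable γ] (l : List β)
    {F : β → α → γ} (h : ∀ b, Primrec (F b)) : Primrec fun a => l.map (F · a) := by
  induction l with
  | nil => exact .const []
  | cons b l ih => exact Primrec.list_cons.comp (h b) ih

theorem primrec_natBits : Primrec Nat.bits := by
  have h : Primrec₂ fun (_ : Unit) (l : List (List Bool)) =>
      if l.length = 0 then some [] else
        (l[l.length.div2]?).map (l.length.bodd :: ·) :=
    (Primrec.ite (Primrec.eq.comp (Primrec.list_length.comp .snd) (.const 0)) (.const _)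
      (Primrec.option_map
        (Primrec.list_getElem?.comp .snd (Primrec.nat_div2.comp (Primrec.list_length.comp .snd)))
        (Primrec.list_cons.comp
          (Primrec.nat_bodd.comp (Primrec.list_length.comp (Primrec.snd.comp .fst))) .snd).to₂)).to₂
  have : Primrec₂ fun (_ : Unit) n => Nat.bits n := by
    refine Primrec.nat_strong_rec _ h fun _ n => ?_
    cases n using Nat.binaryRec' with
    | zero => simp
    | bit b m hb =>
      have hm : m < Nat.bit b m := by
        cases b <;> grind [Nat.bit_val]
      simp [Nat.bits_append_bit m b hb, List.getElem?_range hm, Nat.ne_zero_of_lt hm]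
  exact this.comp (.const ()) .id

theorem trNat_eq_map_bits (n : ℕ) :
    PartrecToTM2.trNat n = n.bits.map fun b => cond b .bit1 .bit0 := by
  induction n using Nat.binaryRec' with
  | zero => simp
  | bit b m hn ih =>
    rw [Nat.bits_append_bit m b hn, List.map_cons, ← ih, PartrecToTM2.trNat, PartrecToTM2.trNat,
      ← Num.ofNat'_eq, Num.ofNat'_bit, Num.ofNat'_eq]
    cases b with
    | true => cases (m : Num) <;> rfl
    | false =>
      have hm : (m : Num) ≠ 0 := by simpa using hn
      cases hmNum : (m : Num) with
      | zero => exact absurd hmNum hm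
      | pos p => rfl

namespace DPDA

section Runs

variable {Q A Γ : Type} {M : DPDA Q A Γ}

theorem Step.unique {a : A} {c c₁ c₂ : Q × List Γ} (h₁ : M.Step a c c₁) (h₂ : M.Step a c c₂) :
    c₁ = c₂ := by
  obtain ⟨υ₁, x₁, hc₁, rfl⟩ := h₁
  obtain ⟨υ₂, x₂, hc₂, rfl⟩ := h₂
  obtain ⟨rfl, hx⟩ := List.append_inj' (hc₁.symm.trans hc₂) rfl
  obtain rfl : x₁ = x₂ := by simpa using hx
  rfl

theorem IsRun.eq_of_le {w : List A} {ρ₁ ρ₂ : ℕ → Q × List Γ} (h₁ : M.IsRun w ρ₁)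
    (h₂ : M.IsRun w ρ₂) {i : ℕ} (hi : i ≤ w.length) : ρ₁ i = ρ₂ i := by
  induction i with
  | zero => exact h₁.1.trans h₂.1.symm
  | succ i ih =>
    have hstep := h₁.2 i hi
    rw [ih (by omega)] at hstep
    exact hstep.unique (h₂.2 i hi)

theorem IsRun.mem_language_iff {w : List A} {ρ : ℕ → Q × List Γ} (h : M.IsRun w ρ) :
    w ∈ M.language ↔ (ρ w.length).1 ∈ M.final := by
  refine ⟨?_, fun hf => ⟨ρ, h, hf⟩⟩
  rintro ⟨ρ', h', hf⟩
  rwa [h.eq_of_le h' le_rfl]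

theorem splitsIntoStrokes_two {ρ : ℕ → Q × List Γ} {m n : ℕ} (hmn : m ≤ n)
    (hup : IsUpstroke ρ 0 m) (hdown : IsDownstroke ρ m n) : SplitsIntoStrokes ρ n 2 := by
  refine ⟨fun j => if j = 0 then 0 else if j = 1 then m else n, ?_, rfl, rfl, ?_⟩
  · intro i j hij
    dsimp only
    split_ifs <;> omega
  · intro j hj
    obtain rfl | rfl : j = 0 ∨ j = 1 := by omega
    · exact .inl hup
    · exact .inr hdown

theorem isNTurn_one_of_state_set (U : Set Q) (hup : ∀ q ∈ U, ∀ a x, (M.δ q a x).2 ≠ [])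
    (hdown : ∀ q ∉ U, ∀ a x, (M.δ q a x).1 ∉ U ∧ (M.δ q a x).2.length ≤ 1) : M.IsNTurn 1 := by
  classical
  intro w _ ρ ⟨_, hρ⟩
  have hturn : ∃ i, i = w.length ∨ (ρ i).1 ∉ U := ⟨_, .inl rfl⟩
  have hturn_le : Nat.find hturn ≤ w.length := Nat.find_min' hturn (.inl rfl)
  have hstays : ∀ i, Nat.find hturn ≤ i → i < w.length → (ρ i).1 ∉ U := by
    intro i hi
    induction i, hi using Nat.le_induction with
    | base => exact fun hlt => (Nat.find_spec hturn).resolve_left hlt.ne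
    | succ i _ ih =>
      intro hlt
      obtain ⟨υ, x, -, hnext⟩ := hρ i (by omega)
      rw [hnext]
      exact (hdown _ (ih (by omega)) _ x).1
  refine splitsIntoStrokes_two hturn_le (fun i _ hi => ?_) (fun i hi hi' => ?_)
  · have hU : (ρ i).1 ∈ U := by
      by_contra hU
      exact Nat.find_min hturn hi (.inr hU)
    obtain ⟨υ, x, htop, hnext⟩ := hρ i (hi.trans_le hturn_le)
    have := List.length_pos_iff.2 (hup _ hU w[i] x)
    simp only [htop, hnext, List.length_append, List.length_singleton]
    omega
  · obtain ⟨υ, x, htop, hnext⟩ := hρ i hi'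
    have := (hdown _ (hstays i hi hi') w[i] x).2
    simp only [htop, hnext, List.length_append, List.length_singleton]
    omega

end Runs

section Reindex

variable {Q A Γ Q' A' Γ' : Type}

/-- Renaming the states, letters and stack symbols of an automaton. -/
@[simps]
def reindex (M : DPDA Q A Γ) (e : Q ≃ Q') (f : A ≃ A') (g : Γ ≃ Γ') : DPDA Q' A' Γ' where
  δ q a x := Prod.map e (List.map g) (M.δ (e.symm q) (f.symm a) (g.symm x))
  start := e M.start
  bot := g M.bot
  final := M.final.map e.toEmbedding
  bot_rule q a x h := by
    obtain ⟨hx, γ, hγ, hb⟩ := M.bot_rule (e.symm q) (f.symm a) (g.symm x) (by simpa using h)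
    exact ⟨by simp [← hx], γ.map g, by simp [hγ], by simpa using hb⟩

variable (M : DPDA Q A Γ) (e : Q ≃ Q') (f : A ≃ A') (g : Γ ≃ Γ')

theorem Step.reindex {M : DPDA Q A Γ} {a : A} {c c' : Q × List Γ} (h : M.Step a c c') :
    (M.reindex e f g).Step (f a) (Prod.map e (List.map g) c) (Prod.map e (List.map g) c') := by
  obtain ⟨υ, x, hc, rfl⟩ := h
  exact ⟨υ.map g, g x, by simp [hc], by simp⟩

theorem IsRun.reindex {M : DPDA Q A Γ} {w : List A} {ρ : ℕ → Q × List Γ} (h : M.IsRun w ρ) :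
    (M.reindex e f g).IsRun (w.map f) fun i => Prod.map e (List.map g) (ρ i) := by
  refine ⟨by simp [h.1], fun i hi => ?_⟩
  simpa using (h.2 i (by simpa using hi)).reindex e f g

theorem reindex_symm_reindex : (M.reindex e f g).reindex e.symm f.symm g.symm = M := by
  obtain ⟨δ, start, bot, final, _⟩ := M
  have hδ : (fun q a x => Prod.map e.symm (List.map g.symm)
      (Prod.map e (List.map g) (δ q a x))) = δ := by
    funext q a x
    simp [Prod.map]
  have hfinal : (final.map e.toEmbedding).map e.symm.toEmbedding = final := by
    simp [Finset.map_map]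
  simp [DPDA.reindex, hδ, hfinal]

theorem mem_language_reindex {w : List A'} :
    w ∈ (M.reindex e f g).language ↔ w.map f.symm ∈ M.language := by
  constructor
  · rintro ⟨ρ, hρ, hf⟩
    have := hρ.reindex e.symm f.symm g.symm
    rw [reindex_symm_reindex] at this
    exact ⟨_, this, by simpa [Finset.mem_map_equiv] using hf⟩
  · rintro ⟨ρ, hρ, hf⟩
    refine ⟨_, by simpa using hρ.reindex e f g, by simpa using hf⟩

theorem IsNTurn.reindex {M : DPDA Q A Γ} {n : ℕ} (h : M.IsNTurn n) :
    (M.reindex e f g).IsNTurn n := by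
  intro w hw ρ hρ
  have hrun := hρ.reindex e.symm f.symm g.symm
  rw [reindex_symm_reindex] at hrun
  simpa [SplitsIntoStrokes, IsUpstroke, IsDownstroke] using
    h _ ((M.mem_language_reindex e f g).1 hw) _ hrun

end Reindex

section OfMoves

variable {Q A B : Type}

/-- The automaton that keeps its bottom symbol `none` below a word over `B`. The moves are given in
terms of the last letter of this word (`none` if the word is empty) and replace this letter. -/
def ofMoves (moves : Q → A → Option B → Q × List B) (start : Q) (F : Finset Q) :
    DPDA Q A (Option B) where
  δ q a x := ((moves q a x).1, x.elim [none] (fun _ => []) ++ (moves q a x).2.map some)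
  start := start
  bot := none
  final := F
  bot_rule q a x h := by cases x <;> simp_all

/-- The effect of reading a letter on a state and the word above the bottom symbol. -/
def applyMove (moves : Q → A → Option B → Q × List B) (c : Q × List B) (a : A) : Q × List B :=
  ((moves c.1 a c.2.getLast?).1, c.2.dropLast ++ (moves c.1 a c.2.getLast?).2)

variable (moves : Q → A → Option B → Q × List B) (start : Q) (F : Finset Q)

theorem step_ofMoves (a : A) (c : Q × List B) :
    (ofMoves moves start F).Step a (c.1, none :: c.2.map some)
      ((applyMove moves c a).1, none :: (applyMove moves c a).2.map some) := by
  obtain ⟨q, s⟩ := c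
  cases s using List.reverseRecOn with
  | nil => exact ⟨[], none, rfl, by simp [ofMoves, applyMove]⟩
  | append_singleton s x =>
    exact ⟨none :: s.map some, some x, by simp, by simp [ofMoves, applyMove]⟩

theorem mem_language_ofMoves {w : List A} :
    w ∈ (ofMoves moves start F).language ↔ (w.foldl (applyMove moves) (start, [])).1 ∈ F := by
  let c (i : ℕ) : Q × List B := (w.take i).foldl (applyMove moves) (start, [])
  have hrun : (ofMoves moves start F).IsRun w fun i => ((c i).1, none :: (c i).2.map some) := by
    refine ⟨by simp [c, ofMoves], fun i hi => ?_⟩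
    have hc : c (i + 1) = applyMove moves (c i) w[i] := by
      simp only [c, List.take_add_one, List.getElem?_eq_getElem hi, Option.toList_some,
        List.foldl_append, List.foldl_cons, List.foldl_nil]
    simp only [hc]
    exact step_ofMoves ..
  rw [hrun.mem_language_iff]
  simp [c, ofMoves]

end OfMoves

section Numbered

variable {Q A Γ : Type} [Finite Q] [Finite A] [Finite Γ]

/-- A finite automaton with its states, letters and stack symbols numbered. -/
noncomputable def numbered (M : DPDA Q A Γ) :
    DPDA (Fin (Nat.card Q)) (Fin (Nat.card A)) (Fin (Nat.card Γ)) :=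
  M.reindex (Finite.equivFin Q) (Finite.equivFin A) (Finite.equivFin Γ)

end Numbered

theorem primrec_encode {α : Type} [Primcodable α] {q s g : ℕ}
    {M : α → DPDA (Fin q) (Fin s) (Fin g)} (hδ : ∀ p a x, Primrec fun n => (M n).δ p a x)
    (hstart : Primrec fun n => (M n).start) (hbot : Primrec fun n => (M n).bot)
    (hfinal : ∀ p, Primrec fun n => decide (p ∈ (M n).final)) : Primrec fun n => (M n).encode := by
  refine .pair (.const _) <| .pair (.const _) <| .pair (.const _) <| .pair ?_ <|
    .pair (Primrec.fin_val.comp hstart) <| .pair (Primrec.fin_val.comp hbot) <|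
      primrec_list_map_of_forall _ hfinal
  refine primrec_list_map_of_forall _ fun p => primrec_list_map_of_forall _ fun a =>
    primrec_list_map_of_forall _ fun x => ?_
  have hpushed : Primrec fun n => ((M n).δ p a x).2.map Fin.val :=
    Primrec.list_map (Primrec.snd.comp (hδ p a x)) (Primrec.fin_val.comp .snd).to₂
  have hstate : Primrec fun n => ((M n).δ p a x).1.val :=
    Primrec.fin_val.comp (Primrec.fst.comp (hδ p a x))
  -- The coercion of a list in `DPDA.encode` is a bind in the list monad.
  exact (hstate.pair hpushed).of_eq fun n => by simp [List.map_eq_flatMap]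

end DPDA

namespace OneTurnPair

section OfFinite

variable {Q₁ Q₂ A Γ₁ Γ₂ : Type} [Finite Q₁] [Finite Q₂] [Finite A] [Finite Γ₁] [Finite Γ₂]

/-- The pair of two finite 1-turn automata, with numbered states, letters and stack symbols. -/
noncomputable def ofFinite (M₁ : DPDA Q₁ A Γ₁) (M₂ : DPDA Q₂ A Γ₂) (h₁ : M₁.IsNTurn 1)
    (h₂ : M₂.IsNTurn 1) : OneTurnPair where
  letters := Nat.card A
  states₁ := Nat.card Q₁
  states₂ := Nat.card Q₂
  stack₁ := Nat.card Γ₁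
  stack₂ := Nat.card Γ₂
  M₁ := M₁.numbered
  M₂ := M₂.numbered
  oneTurn₁ := h₁.reindex _ _ _
  oneTurn₂ := h₂.reindex _ _ _

variable {M₁ : DPDA Q₁ A Γ₁} {M₂ : DPDA Q₂ A Γ₂} (h₁ : M₁.IsNTurn 1) (h₂ : M₂.IsNTurn 1)

theorem encode_ofFinite :
    (ofFinite M₁ M₂ h₁ h₂).encode = (M₁.numbered.encode, M₂.numbered.encode) := rfl

theorem disjoint_ofFinite_iff :
    (ofFinite M₁ M₂ h₁ h₂).M₁.language ⊓ (ofFinite M₁ M₂ h₁ h₂).M₂.language = ⊥ ↔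
      M₁.language ⊓ M₂.language = ⊥ := by
  have hsurj := List.map_surjective_iff.2 (Finite.equivFin A).symm.surjective
  refine Set.eq_empty_iff_forall_notMem.trans (.trans ?_ Set.eq_empty_iff_forall_notMem.symm)
  rw [hsurj.forall]
  refine forall_congr' fun w => not_congr ?_
  exact and_congr (DPDA.mem_language_reindex ..) (DPDA.mem_language_reindex ..)

theorem le_ofFinite_iff :
    (ofFinite M₁ M₂ h₁ h₂).M₁.language ≤ (ofFinite M₁ M₂ h₁ h₂).M₂.language ↔
      M₁.language ≤ M₂.language := by
  have hsurj := List.map_surjective_iff.2 (Finite.equivFin A).symm.surjective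
  refine Iff.trans ?_ hsurj.forall.symm
  refine forall_congr' fun w => ?_
  exact imp_congr (DPDA.mem_language_reindex ..) (DPDA.mem_language_reindex ..)

end OfFinite

end OneTurnPair

/-- A deterministic letter-to-word transducer without a distinguished initial state. -/
structure Transducer (P B : Type) where
  next : P → B → P
  out : P → B → List B

namespace Transducer

section Basic

variable {P B : Type} (T : Transducer P B)

/-- The state of a transducer after reading a word, and the word that it has written. -/
def traverse : P → List B → P × List B
  | p, [] => (p, [])
  | p, b :: z => ((traverse (T.next p b) z).1, T.out p b ++ (traverse (T.next p b) z).2)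

/-- The word written by a transducer while it reads a word. -/
def outputs (p : P) (z : List B) : List B := (T.traverse p z).2

/-- Some input consists of `u` followed by the output on this very input. It lists the letters that
the queue machine `Transducer.queueStep` removes from the queue `u` until it halts. -/
def Reproduces (p : P) (u : List B) : Prop := ∃ z, z = u ++ T.outputs p z

/-- A transducer as a queue machine: each step removes the first letter of the queue and appends
the corresponding output. The machine stops when its queue is empty. -/
def queueStep : P × List B → Option (P × List B)
  | (_, []) => none
  | (p, b :: u) => some (T.next p b, u ++ T.out p b)

theorem outputs_nil (p : P) : T.outputs p [] = [] := rfl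

theorem outputs_cons (p : P) (b : B) (z : List B) :
    T.outputs p (b :: z) = T.out p b ++ T.outputs (T.next p b) z := rfl

theorem reproduces_nil (p : P) : T.Reproduces p [] := ⟨[], rfl⟩

theorem reproduces_cons {p : P} {b : B} {u : List B} :
    T.Reproduces p (b :: u) ↔ T.Reproduces (T.next p b) (u ++ T.out p b) := by
  constructor
  · rintro ⟨_ | ⟨c, z⟩, hz⟩
    · simp at hz
    · obtain rfl := List.head_eq_of_cons_eq hz
      exact ⟨z, by simpa [outputs_cons] using hz⟩
  · rintro ⟨z, hz⟩
    exact ⟨b :: z, by simpa [outputs_cons] using hz⟩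

theorem reproduces_iff_dom {p : P} {u : List B} :
    T.Reproduces p u ↔ (eval T.queueStep (p, u)).Dom := by
  constructor
  · rintro ⟨z, hz⟩
    induction z generalizing p u with
    | nil =>
      obtain ⟨rfl, -⟩ := List.append_eq_nil_iff.1 hz.symm
      exact Part.dom_iff_mem.2 ⟨_, mem_eval.2 ⟨.refl, rfl⟩⟩
    | cons b z ih =>
      cases u with
      | nil => exact Part.dom_iff_mem.2 ⟨_, mem_eval.2 ⟨.refl, rfl⟩⟩
      | cons c u =>
        obtain rfl := List.head_eq_of_cons_eq hz
        have hstep : (T.next p b, u ++ T.out p b) ∈ T.queueStep (p, b :: u) := rfl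
        rw [reaches_eval (.single hstep)]
        exact ih (by simpa [outputs_cons] using hz)
  · intro h
    obtain ⟨c, hc⟩ := Part.dom_iff_mem.1 h
    exact evalInduction (C := fun a => T.Reproduces a.1 a.2) hc fun
      | (p, []), _, _ => T.reproduces_nil p
      | (_, _ :: _), _, ih => T.reproduces_cons.2 (ih _ rfl)

theorem reaches_queueStep_traverse (p : P) (x u : List B) :
    Reaches T.queueStep (p, x ++ u) ((T.traverse p x).1, u ++ (T.traverse p x).2) := by
  induction x generalizing p u with
  | nil =>
    rw [traverse, List.append_nil]
    exact .refl
  | cons b x ih =>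
    have hstep : (T.next p b, x ++ u ++ T.out p b) ∈ T.queueStep (p, b :: x ++ u) := rfl
    refine .head hstep ?_
    have := ih (T.next p b) (u ++ T.out p b)
    rwa [← List.append_assoc, List.append_assoc u] at this

theorem reaches₁_queueStep_traverse (p : P) {x : List B} (hx : x ≠ []) :
    Reaches₁ T.queueStep (p, x) (T.traverse p x) := by
  obtain ⟨b, x, rfl⟩ := List.exists_cons_of_ne_nil hx
  have hstep : (T.next p b, x ++ T.out p b) ∈ T.queueStep (p, b :: x) := rfl
  exact .head' hstep <| T.reaches_queueStep_traverse (T.next p b) x (T.out p b)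

/-- The restriction of a transducer to a set of states that is closed under its transitions. -/
def restrict (S : Set P) (h : ∀ p ∈ S, ∀ b, T.next p b ∈ S) : Transducer S B where
  next p b := ⟨T.next p b, h p p.2 b⟩
  out p b := T.out p b

theorem outputs_restrict (S : Set P) (h : ∀ p ∈ S, ∀ b, T.next p b ∈ S) (p : S) (z : List B) :
    (T.restrict S h).outputs p z = T.outputs p z := by
  induction z generalizing p with
  | nil => rfl
  | cons b z ih => exact congrArg (T.out p b ++ ·) (ih _)

/-- The transducer that writes what it reads. -/
def copy (B : Type) : Transducer Unit B where
  next _ _ := ()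
  out _ b := [b]

theorem outputs_copy (z : List B) : (copy B).outputs () z = z := by
  induction z with
  | nil => rfl
  | cons b z ih => exact congrArg (b :: ·) ih

end Basic

/-- The control states of the automaton `Transducer.matcher`. -/
inductive Phase (P : Type) where
  | init
  | up (p : P)
  | down
  | accepted
  | dead

instance {P : Type} [Finite P] : Finite (Phase P) := by
  refine .of_surjective (fun x : Option P ⊕ Fin 3 => x.elim
    (fun p => p.elim .init .up) ![.down, .accepted, .dead]) fun q => ?_
  cases q with
  | init => exact ⟨.inl none, rfl⟩
  | up p => exact ⟨.inl (some p), rfl⟩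
  | down => exact ⟨.inr 0, rfl⟩
  | accepted => exact ⟨.inr 1, rfl⟩
  | dead => exact ⟨.inr 2, rfl⟩

section Matcher

variable {P B : Type}

/-- The word that describes an input `z` followed by the reversal of a word `y`. It is read by the
automaton that pushes its computation of `y` from `z` and then compares it with the rest of the
input. -/
def transcript (z y : List B) : List (Option B) :=
  none :: (z.map some ++ none :: (y.reverse.map some ++ [none]))

theorem map_some_append_none_cons_inj {z z' : List B} {r r' : List (Option B)} :
    z.map some ++ none :: r = z'.map some ++ none :: r' ↔ z = z' ∧ r = r' := by
  induction z generalizing z' with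
  | nil => cases z' <;> simp
  | cons b z ih => cases z' <;> simp [ih, and_assoc]

theorem transcript_inj {z z' y y' : List B} :
    transcript z y = transcript z' y' ↔ z = z' ∧ y = y' := by
  simp only [transcript, List.cons.injEq, true_and, map_some_append_none_cons_inj, and_true,
    List.reverse_inj]

theorem dropLast_append_toList_getLast? (s : List B) : s.dropLast ++ s.getLast?.toList = s := by
  cases s using List.reverseRecOn <;> simp

variable [DecidableEq B] (T : Transducer P B) (p₀ : P) (u : List B)

/-- The moves of `Transducer.matcher`. -/
def matcherMoves : Phase P → Option B → Option B → Phase P × List B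
  | .init, none, x => (.up p₀, x.toList ++ u)
  | .up p, some b, x => (.up (T.next p b), x.toList ++ T.out p b)
  | .up _, none, x => (.down, x.toList)
  | .down, some b, some c => if b = c then (.down, []) else (.dead, [c])
  | .down, none, none => (.accepted, [])
  | _, _, x => (.dead, x.toList)

/-- An automaton that pushes `u` and the output of the transducer while it reads an input, and then
compares the stack with the rest of its word. It reaches the state `accepted` on the words
`transcript z (u ++ T.outputs p₀ z)`. -/
def matcher (F : Finset (Phase P)) : DPDA (Phase P) (Option B) (Option B) :=
  .ofMoves (T.matcherMoves p₀ u) .init F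

theorem isNTurn_matcher (F : Finset (Phase P)) : (T.matcher p₀ u F).IsNTurn 1 := by
  refine DPDA.isNTurn_one_of_state_set ({.init} ∪ Set.range .up) (fun q hq a x => ?_)
    (fun q hq a x => ?_)
  · obtain rfl | ⟨p, rfl⟩ := hq <;> cases a <;> cases x <;>
      simp [matcher, DPDA.ofMoves, matcherMoves]
  · cases q <;> cases a <;> cases x <;> simp_all [matcher, DPDA.ofMoves, matcherMoves]
    split_ifs <;> simp

/-- The state of `Transducer.matcher` after a word that is read from a state and stack. -/
def matcherRun (c : Phase P × List B) (w : List (Option B)) : Phase P :=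
  (w.foldl (DPDA.applyMove (T.matcherMoves p₀ u)) c).1

theorem matcherRun_nil (c : Phase P × List B) : T.matcherRun p₀ u c [] = c.1 := rfl

theorem matcherRun_cons (c : Phase P × List B) (a : Option B) (w : List (Option B)) :
    T.matcherRun p₀ u c (a :: w) =
      T.matcherRun p₀ u (DPDA.applyMove (T.matcherMoves p₀ u) c a) w := rfl

theorem matcherRun_dead (s : List B) (w : List (Option B)) :
    T.matcherRun p₀ u (.dead, s) w = .dead := by
  induction w generalizing s with
  | nil => rfl
  | cons _ _ ih => exact ih _

theorem matcherRun_down {s : List B} {w : List (Option B)} :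
    T.matcherRun p₀ u (.down, s) w = .accepted ↔ w = s.reverse.map some ++ [none] := by
  induction w generalizing s with
  | nil => simp [matcherRun_nil]
  | cons a w ih =>
    rw [matcherRun_cons]
    cases s using List.reverseRecOn with
    | nil =>
      cases a with
      | none =>
        cases w <;> simp [DPDA.applyMove, matcherMoves, matcherRun_nil, matcherRun_cons,
          matcherRun_dead]
      | some b => simp [DPDA.applyMove, matcherMoves, matcherRun_dead]
    | append_singleton s c =>
      cases a with
      | none => simp [DPDA.applyMove, matcherMoves, matcherRun_dead]
      | some b =>
        by_cases hbc : b = c <;>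
          simp [DPDA.applyMove, matcherMoves, matcherRun_dead, hbc, ih]

theorem matcherRun_up {p : P} {s : List B} {w : List (Option B)} :
    T.matcherRun p₀ u (.up p, s) w = .accepted ↔
      ∃ z, none :: w = transcript z (s ++ T.outputs p z) := by
  simp only [transcript, List.cons.injEq, true_and]
  induction w generalizing p s with
  | nil => simp [matcherRun_nil]
  | cons a w ih =>
    rw [matcherRun_cons]
    cases a with
    | none =>
      simp only [DPDA.applyMove, matcherMoves, dropLast_append_toList_getLast?, matcherRun_down]
      refine ⟨fun hw => ⟨[], by simp [hw, outputs_nil]⟩, ?_⟩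
      rintro ⟨_ | ⟨b, z⟩, hz⟩
      · simpa [outputs_nil, outputs_cons] using hz
      · simp at hz
    | some b =>
      simp only [DPDA.applyMove, matcherMoves, ← List.append_assoc,
        dropLast_append_toList_getLast?, ih]
      constructor
      · rintro ⟨z, rfl⟩
        exact ⟨b :: z, by simp [outputs_cons]⟩
      · rintro ⟨_ | ⟨c, z⟩, hz⟩
        · simp at hz
        · obtain ⟨rfl, rfl⟩ : b = c ∧ _ := by simpa using hz
          exact ⟨z, by simp [outputs_cons]⟩

theorem matcherRun_init {w : List (Option B)} :
    T.matcherRun p₀ u (.init, []) w = .accepted ↔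
      ∃ z, w = transcript z (u ++ T.outputs p₀ z) := by
  cases w with
  | nil => simp [matcherRun_nil, transcript]
  | cons a w =>
    rw [matcherRun_cons]
    cases a with
    | none => simp [DPDA.applyMove, matcherMoves, matcherRun_up]
    | some b => simp [DPDA.applyMove, matcherMoves, matcherRun_dead, transcript]

theorem mem_language_matcher {F : Finset (Phase P)} {w : List (Option B)} :
    w ∈ (T.matcher p₀ u F).language ↔ T.matcherRun p₀ u (.init, []) w ∈ F :=
  DPDA.mem_language_ofMoves ..

theorem reproduces_iff_exists_accepted :
    T.Reproduces p₀ u ↔ ∃ w, (copy B).matcherRun () [] (.init, []) w = .accepted ∧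
      T.matcherRun p₀ u (.init, []) w = .accepted := by
  simp only [matcherRun_init, outputs_copy, List.nil_append]
  constructor
  · rintro ⟨z, hz⟩
    exact ⟨_, ⟨z, rfl⟩, z, transcript_inj.2 ⟨rfl, hz⟩⟩
  · rintro ⟨_, ⟨z, rfl⟩, z', h⟩
    obtain ⟨rfl, hz⟩ := transcript_inj.1 h
    exact ⟨z, hz⟩

theorem matcher_disjoint_iff :
    ((copy B).matcher () [] {.accepted}).language ⊓ (T.matcher p₀ u {.accepted}).language = ⊥ ↔
      ¬ T.Reproduces p₀ u := by
  rw [reproduces_iff_exists_accepted, not_exists]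
  refine Set.eq_empty_iff_forall_notMem.trans (forall_congr' fun w => not_congr ?_)
  refine (and_congr (mem_language_matcher ..) (mem_language_matcher ..)).trans ?_
  simp only [Finset.mem_singleton]

theorem matcher_le_iff {F : Finset (Phase P)} (hF : ∀ q, q ∈ F ↔ q ≠ .accepted) :
    ((copy B).matcher () [] {.accepted}).language ≤ (T.matcher p₀ u F).language ↔
      ¬ T.Reproduces p₀ u := by
  rw [reproduces_iff_exists_accepted, not_exists]
  refine forall_congr' fun w => ?_
  refine (imp_congr (mem_language_matcher ..) (mem_language_matcher ..)).trans ?_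
  simp only [Finset.mem_singleton, hF, not_and, ne_eq]

theorem primrec_encode_matcher [Finite P] [Finite B] [Primcodable B] {α : Type} [Primcodable α]
    {u : α → List B} (hu : Primrec u) (F : Finset (Phase P)) :
    Primrec fun n => (T.matcher p₀ (u n) F).numbered.encode := by
  let eP := Finite.equivFin (Phase P)
  let eB := Finite.equivFin (Option B)
  have hmove (q : Phase P) (a x : Option B) :
      Primrec fun n => ((T.matcherMoves p₀ (u n) q a x).2.map fun b => eB (some b)) := by
    by_cases h : q = .init ∧ a = none
    · obtain ⟨rfl, rfl⟩ := h
      have hmap : Primrec fun b : B => eB (some b) := .dom_finite _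
      exact Primrec.list_map (Primrec.list_append.comp (.const x.toList) hu) (hmap.comp .snd).to₂
    · refine (Primrec.const ((T.matcherMoves p₀ [] q a x).2.map fun b => eB (some b))).of_eq ?_
      cases q <;> cases a <;> cases x <;> simp_all [matcherMoves]
  have hstate (q : Phase P) (a x : Option B) :
      Primrec fun n => eP (T.matcherMoves p₀ (u n) q a x).1 := by
    refine (Primrec.const (eP (T.matcherMoves p₀ [] q a x).1)).of_eq ?_
    cases q <;> cases a <;> cases x <;> simp [matcherMoves]
  refine DPDA.primrec_encode (fun q a x => ?_) (.const (eP .init)) (.const (eB none))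
    (fun p => .const (decide (p ∈ F.map eP.toEmbedding)))
  refine ((hstate (eP.symm q) (eB.symm a) (eB.symm x)).pair (Primrec.list_append.comp
    (.const (((eB.symm x).elim [none] fun _ => []).map eB))
    (hmove (eP.symm q) (eB.symm a) (eB.symm x)))).of_eq fun n => ?_
  simp [DPDA.numbered, matcher, DPDA.ofMoves, eP, eB, Function.comp_def]

/-- The 1-turn automata that accept the transcripts of copying and those of the transducer `T`, the
latter with the final states `F`. -/
noncomputable def matcherPair [Finite P] [Finite B] (F : Finset (Phase P)) : OneTurnPair :=
  .ofFinite ((copy B).matcher () [] {.accepted}) (T.matcher p₀ u F)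
    ((copy B).isNTurn_matcher () [] _) (T.isNTurn_matcher p₀ u F)

theorem primrec_encode_matcherPair [Finite P] [Finite B] [Primcodable B] {α : Type} [Primcodable α]
    {u : α → List B} (hu : Primrec u) (F : Finset (Phase P)) :
    Primrec fun n => (T.matcherPair p₀ (u n) F).encode :=
  (Primrec.const ((copy B).matcher () [] {.accepted}).numbered.encode).pair
    (T.primrec_encode_matcher p₀ hu F) |>.of_eq fun _ => (OneTurnPair.encode_ofFinite ..).symm

end Matcher

end Transducer

namespace StackMachine

section Stacks

variable {K : Type} {Γ : K → Type}

/-- A shuffle of stacks as the content of a queue. The letter `none` marks its end. -/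
def queueWord (L : List (Σ k, Γ k)) : List (Option (Σ k, Γ k)) := L.map some ++ [none]

theorem queueWord_nil : queueWord ([] : List (Σ k, Γ k)) = [none] := rfl

theorem queueWord_cons (s : Σ k, Γ k) (L : List (Σ k, Γ k)) :
    queueWord (s :: L) = some s :: queueWord L := rfl

variable [DecidableEq K]

/-- The stacks of which a list of labelled symbols is a shuffle. The first symbol with label `k` is
the top of the stack `k`. -/
def unshuffle (L : List (Σ k, Γ k)) (k : K) : List (Γ k) := L.lookupAll k

theorem head?_unshuffle (L : List (Σ k, Γ k)) (k : K) : (unshuffle L k).head? = L.dlookup k :=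
  L.head?_lookupAll k

theorem unshuffle_cons (L : List (Σ k, Γ k)) (k : K) (x : Γ k) :
    unshuffle (⟨k, x⟩ :: L) = Function.update (unshuffle L) k (x :: unshuffle L k) := by
  funext j
  obtain rfl | hj := eq_or_ne j k
  · simp [unshuffle]
  · simp [unshuffle, hj]

theorem unshuffle_kerase (L : List (Σ k, Γ k)) (k : K) :
    unshuffle (L.kerase k) = Function.update (unshuffle L) k (unshuffle L k).tail := by
  induction L with
  | nil =>
    funext j
    obtain rfl | hj := eq_or_ne j k <;> simp [unshuffle, *]
  | cons s L ih =>
    obtain ⟨i, x⟩ := s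
    obtain rfl | hi := eq_or_ne k i
    · simp [unshuffle_cons]
    · rw [List.kerase_cons_ne hi, unshuffle_cons, unshuffle_cons, ih, Function.update_comm hi]
      simp [hi, hi.symm]

theorem unshuffle_map_mk (k : K) (s : List (Γ k)) :
    unshuffle (s.map (Sigma.mk k)) = Function.update (fun _ => []) k s := by
  induction s with
  | nil => simp [unshuffle, funext_iff]
  | cons x s ih => simp [unshuffle_cons, ih]

end Stacks

/-- The control states of `StackMachine.transducer`. In a state `exec q v` the statement `q` is to
be executed with the local variable `v`; in a state `sweep q v` the rest of the queue is to be
copied before that. -/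
inductive Control {K : Type} (Γ : K → Type) (Λ σ : Type) where
  | exec (q : TM2.Stmt Γ Λ σ) (v : σ)
  | sweep (q : TM2.Stmt Γ Λ σ) (v : σ)
  | halted

variable {K : Type} {Γ : K → Type} {Λ σ : Type}

/-- The control state that continues with `exec q v` after the end marker. -/
def Control.resume (q : TM2.Stmt Γ Λ σ) (v : σ) : Option (Σ k, Γ k) → Control Γ Λ σ
  | none => .exec q v
  | some _ => .sweep q v

section Support

variable {M : Λ → TM2.Stmt Γ Λ σ} {L : Finset Λ}

variable (M) in
/-- The statements that occur in the programs of the labels in `L`. -/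
def statements (L : Finset Λ) : Set (TM2.Stmt Γ Λ σ) := ⋃ l ∈ L, TM2.stmts₁ (M l)

variable (M) in
/-- The control states of the simulation of the programs of the labels in `L`. -/
def support (L : Finset Λ) : Set (Control Γ Λ σ) :=
  Set.image2 .exec (statements M L) .univ ∪ Set.image2 .sweep (statements M L) .univ ∪ {.halted}

variable (M) in
theorem finite_support [Finite σ] (L : Finset Λ) : (support M L).Finite := by
  have hfin : (statements M L).Finite :=
    L.finite_toSet.biUnion fun l _ => (TM2.stmts₁ (M l)).finite_toSet
  exact ((hfin.image2 _ Set.finite_univ).union (hfin.image2 _ Set.finite_univ)).union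
    (Set.finite_singleton _)

theorem mem_statements {q : TM2.Stmt Γ Λ σ} :
    q ∈ statements M L ↔ ∃ l ∈ L, q ∈ TM2.stmts₁ (M l) := by
  simp only [statements, Set.mem_iUnion₂, Finset.mem_coe, exists_prop]

theorem apply_mem_statements {l : Λ} (hl : l ∈ L) : M l ∈ statements M L :=
  mem_statements.2 ⟨l, hl, TM2.stmts₁_self⟩

theorem statements_trans {q q' : TM2.Stmt Γ Λ σ} (hq' : q' ∈ TM2.stmts₁ q)
    (hq : q ∈ statements M L) : q' ∈ statements M L := by
  obtain ⟨l, hl, hq⟩ := mem_statements.1 hq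
  exact mem_statements.2 ⟨l, hl, TM2.stmts₁_trans hq hq'⟩

theorem exec_mem_support {q : TM2.Stmt Γ Λ σ} (hq : q ∈ statements M L) (v : σ) :
    .exec q v ∈ support M L :=
  .inl (.inl ⟨q, hq, v, trivial, rfl⟩)

theorem sweep_mem_support {q : TM2.Stmt Γ Λ σ} (hq : q ∈ statements M L) (v : σ) :
    .sweep q v ∈ support M L :=
  .inl (.inr ⟨q, hq, v, trivial, rfl⟩)

theorem halted_mem_support : .halted ∈ support M L := .inr rfl

theorem resume_mem_support {q : TM2.Stmt Γ Λ σ} (hq : q ∈ statements M L) (v : σ)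
    (b : Option (Σ k, Γ k)) : .resume q v b ∈ support M L := by
  cases b with
  | none => exact exec_mem_support hq v
  | some s => exact sweep_mem_support hq v

end Support

variable [DecidableEq K] (M : Λ → TM2.Stmt Γ Λ σ)

/-- The transitions of `StackMachine.transducer`. An instruction that reads the stack `k` is
executed at the first symbol with label `k`, or at the end marker if there is none. -/
def move : Control Γ Λ σ → Option (Σ k, Γ k) → Control Γ Λ σ × List (Option (Σ k, Γ k))
  | .exec (.push k f q) v, b => (.resume q v b, [some ⟨k, f v⟩, b])
  | .exec (.peek _ f q) v, none => (.exec q (f v none), [none])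
  | .exec (.peek k f q) v, some ⟨j, x⟩ =>
    (if h : j = k then .sweep q (f v (some (h ▸ x))) else .exec (.peek k f q) v, [some ⟨j, x⟩])
  | .exec (.pop _ f q) v, none => (.exec q (f v none), [none])
  | .exec (.pop k f q) v, some ⟨j, x⟩ =>
    if h : j = k then (.sweep q (f v (some (h ▸ x))), [])
    else (.exec (.pop k f q) v, [some ⟨j, x⟩])
  | .exec (.load f q) v, b => (.resume q (f v) b, [b])
  | .exec (.branch f q₁ q₂) v, b => (.resume (cond (f v) q₁ q₂) v b, [b])
  | .exec (.goto l) v, b => (.resume (M (l v)) v b, [b])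
  | .exec .halt _, _ => (.halted, [])
  | .sweep q v, b => (.resume q v b, [b])
  | .halted, _ => (.halted, [])

/-- A transducer whose queue machine simulates a machine with several stacks. The queue contains a
shuffle of the stacks, and one passage through the queue executes one instruction. -/
def transducer : Transducer (Control Γ Λ σ) (Option (Σ k, Γ k)) where
  next p b := (move M p b).1
  out p b := (move M p b).2

section Passages

variable {M} {q : TM2.Stmt Γ Λ σ} {v : σ} {L : List (Σ k, Γ k)}

theorem traverse_nil (p : Control Γ Λ σ) :
    (transducer M).traverse p [none] = move M p none := by
  simp [Transducer.traverse, transducer]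

theorem traverse_cons (p : Control Γ Λ σ) (s : Σ k, Γ k) :
    (transducer M).traverse p (some s :: queueWord L) =
      let (p', r) := move M p (some s)
      let (p'', w) := (transducer M).traverse p' (queueWord L)
      (p'', r ++ w) := rfl

theorem traverse_sweep :
    (transducer M).traverse (.sweep q v) (queueWord L) = (.exec q v, queueWord L) := by
  induction L with
  | nil => rfl
  | cons s L ih =>
    simp [queueWord_cons, traverse_cons, move, Control.resume, ih]

theorem traverse_of_resume {p : Control Γ Λ σ} {r : List (Option (Σ k, Γ k))}
    (h : ∀ b, move M p b = (.resume q v b, r ++ [b])) :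
    (transducer M).traverse p (queueWord L) = (.exec q v, r ++ queueWord L) := by
  cases L with
  | nil => simp [queueWord_nil, traverse_nil, h, Control.resume]
  | cons s L => simp [queueWord_cons, traverse_cons, h, Control.resume, traverse_sweep]

theorem traverse_peek {k : K} {f : σ → Option (Γ k) → σ} :
    (transducer M).traverse (.exec (.peek k f q) v) (queueWord L) =
      (.exec q (f v (L.dlookup k)), queueWord L) := by
  induction L with
  | nil => rfl
  | cons s L ih =>
    obtain ⟨j, x⟩ := s
    obtain rfl | h := eq_or_ne j k
    · simp [queueWord_cons, traverse_cons, move, traverse_sweep]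
    · simp [queueWord_cons, traverse_cons, move, h, h.symm, ih]

theorem traverse_pop {k : K} {f : σ → Option (Γ k) → σ} :
    (transducer M).traverse (.exec (.pop k f q) v) (queueWord L) =
      (.exec q (f v (L.dlookup k)), queueWord (L.kerase k)) := by
  induction L with
  | nil => rfl
  | cons s L ih =>
    obtain ⟨j, x⟩ := s
    obtain rfl | h := eq_or_ne j k
    · simp [queueWord_cons, traverse_cons, move, traverse_sweep]
    · simp [queueWord_cons, traverse_cons, move, h, h.symm, ih]

theorem traverse_halted : (transducer M).traverse .halted (queueWord L) = (.halted, []) := by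
  induction L with
  | nil => rfl
  | cons s L ih => simp [queueWord_cons, traverse_cons, move, ih]

theorem traverse_halt :
    (transducer M).traverse (.exec .halt v) (queueWord L) = (.halted, []) := by
  cases L with
  | nil => rfl
  | cons s L => simp [queueWord_cons, traverse_cons, move, traverse_halted]

end Passages

/-- The configurations of the queue machine that represent a configuration of the machine `M`. -/
def Represents : TM2.Cfg Γ Λ σ → Control Γ Λ σ × List (Option (Σ k, Γ k)) → Prop
  | ⟨none, _, _⟩, c => c.2 = []
  | ⟨some l, v, S⟩, c => ∃ L, S = unshuffle L ∧ c = (.exec (M l) v, queueWord L)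

theorem exists_represents_stepAux (q : TM2.Stmt Γ Λ σ) (v : σ) (L : List (Σ k, Γ k)) :
    ∃ c, Represents M (TM2.stepAux q v (unshuffle L)) c ∧
      Reaches₁ (transducer M).queueStep (.exec q v, queueWord L) c := by
  have hpassage (q : TM2.Stmt Γ Λ σ) (v : σ) (L : List (Σ k, Γ k)) :=
    (transducer M).reaches₁_queueStep_traverse (.exec q v) (x := queueWord L) (by simp [queueWord])
  have hcontinue {q q' : TM2.Stmt Γ Λ σ} {v v' : σ} {L L' : List (Σ k, Γ k)} {S : ∀ k, List (Γ k)}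
      (htraverse : (transducer M).traverse (.exec q v) (queueWord L) = (.exec q' v', queueWord L'))
      (hS : S = unshuffle L') (ih : ∃ c, Represents M (TM2.stepAux q' v' (unshuffle L')) c ∧
        Reaches₁ (transducer M).queueStep (.exec q' v', queueWord L') c) :
      ∃ c, Represents M (TM2.stepAux q' v' S) c ∧
        Reaches₁ (transducer M).queueStep (.exec q v, queueWord L) c := by
    obtain ⟨c, hc, hr⟩ := ih
    exact ⟨c, hS ▸ hc, (htraverse ▸ hpassage q v L).trans hr⟩
  induction q generalizing v L with
  | push k f q ih =>
    rw [TM2.stepAux]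
    exact hcontinue (traverse_of_resume (r := [some ⟨k, f v⟩]) fun _ => rfl)
      (unshuffle_cons ..).symm (ih ..)
  | peek k f q ih =>
    rw [TM2.stepAux, head?_unshuffle]
    exact hcontinue traverse_peek rfl (ih ..)
  | pop k f q ih =>
    rw [TM2.stepAux, head?_unshuffle]
    exact hcontinue traverse_pop (unshuffle_kerase ..).symm (ih ..)
  | load f q ih =>
    rw [TM2.stepAux]
    exact hcontinue (traverse_of_resume (r := []) fun _ => rfl) rfl (ih ..)
  | branch f q₁ q₂ ih₁ ih₂ =>
    have htraverse : (transducer M).traverse (.exec (.branch f q₁ q₂) v) (queueWord L) =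
        (.exec (cond (f v) q₁ q₂) v, queueWord L) := traverse_of_resume (r := []) fun _ => rfl
    rw [TM2.stepAux]
    cases hf : f v <;> rw [hf] at htraverse
    · exact hcontinue htraverse rfl (ih₂ ..)
    · exact hcontinue htraverse rfl (ih₁ ..)
  | goto l =>
    have htraverse : (transducer M).traverse (.exec (.goto l) v) (queueWord L) =
        (.exec (M (l v)) v, queueWord L) := traverse_of_resume (r := []) fun _ => rfl
    exact ⟨_, ⟨L, rfl, rfl⟩, htraverse ▸ hpassage (.goto l) v L⟩
  | halt => exact ⟨(.halted, []), rfl, traverse_halt (M := M) ▸ hpassage .halt v L⟩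

theorem respects_represents :
    Respects (TM2.step M) (transducer M).queueStep (Represents M) := by
  rintro ⟨l, v, S⟩ ⟨p, u⟩ h
  cases l with
  | none =>
    obtain rfl : u = [] := h
    rfl
  | some l =>
    obtain ⟨L, rfl, h⟩ := h
    rw [h]
    exact exists_represents_stepAux M (M l) v L

theorem reproduces_iff_dom (l : Λ) (v : σ) (L : List (Σ k, Γ k)) :
    (transducer M).Reproduces (.exec (M l) v) (queueWord L) ↔
      (eval (TM2.step M) ⟨some l, v, unshuffle L⟩).Dom := by
  rw [Transducer.reproduces_iff_dom]
  exact tr_eval_dom (respects_represents M) ⟨L, rfl, rfl⟩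

theorem next_mem_support {L : Finset Λ} (hL : ∀ l ∈ L, TM2.SupportsStmt L (M l)) :
    ∀ p ∈ support M L, ∀ b, (transducer M).next p b ∈ support M L := by
  rintro p ((⟨q, hq, v, -, rfl⟩ | ⟨q, hq, v, -, rfl⟩) | rfl) b
  · have hsub {q'} (hq' : q' ∈ TM2.stmts₁ q) : q' ∈ statements M L := statements_trans hq' hq
    cases q with
    | push k f q =>
      exact resume_mem_support (hsub (by simp [TM2.stmts₁, TM2.stmts₁_self])) v b
    | peek k f q | pop k f q =>
      have hq' : q ∈ statements M L := hsub (by simp [TM2.stmts₁, TM2.stmts₁_self])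
      rcases b with _ | ⟨j, x⟩
      · exact exec_mem_support hq' _
      · by_cases h : j = k
        · simpa [transducer, move, h] using sweep_mem_support hq' _
        · simpa [transducer, move, h] using exec_mem_support hq v
    | load f q =>
      exact resume_mem_support (hsub (by simp [TM2.stmts₁, TM2.stmts₁_self])) (f v) b
    | branch f q₁ q₂ =>
      have hcond : cond (f v) q₁ q₂ ∈ TM2.stmts₁ (.branch f q₁ q₂) := by
        cases f v <;> simp [TM2.stmts₁, TM2.stmts₁_self]
      exact resume_mem_support (hsub hcond) v b
    | goto l =>
      obtain ⟨l', hl', hq⟩ := mem_statements.1 hq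
      have hl : l v ∈ L := TM2.stmts₁_supportsStmt_mono hq (hL l' hl') v
      exact resume_mem_support (apply_mem_statements hl) v b
    | halt => exact halted_mem_support
  · exact resume_mem_support hq v b
  · exact halted_mem_support

end StackMachine

/-- The initial queue of the simulation of a program on the input `n`. -/
def inputQueue (n : ℕ) : List (Option (Σ _ : PartrecToTM2.K', PartrecToTM2.Γ')) :=
  StackMachine.queueWord ((PartrecToTM2.trList [n]).map (Sigma.mk .main))

instance : Finite PartrecToTM2.K' :=
  .of_surjective ![.main, .rev, .aux, .stack] fun k => by
    cases k
    exacts [⟨0, rfl⟩, ⟨1, rfl⟩, ⟨2, rfl⟩, ⟨3, rfl⟩]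

noncomputable instance : Primcodable (Option (Σ _ : PartrecToTM2.K', PartrecToTM2.Γ')) :=
  .ofEquiv _ (Finite.equivFin _)

theorem primrec_inputQueue : Primrec inputQueue := by
  let symbol (b : Bool) : Option (Σ _ : PartrecToTM2.K', PartrecToTM2.Γ') :=
    some ⟨.main, cond b .bit1 .bit0⟩
  have hbits : Primrec fun n => (Nat.bits n).map symbol :=
    Primrec.list_map primrec_natBits ((Primrec.dom_finite symbol).comp .snd).to₂
  refine (Primrec.list_append.comp hbits (.const [some ⟨.main, .cons⟩, none])).of_eq fun n => ?_
  simp [inputQueue, StackMachine.queueWord, PartrecToTM2.trList, trNat_eq_map_bits, symbol,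
    Function.comp_def]

theorem exists_transducer_reproduces_iff_dom (c : ToPartrec.Code) :
    ∃ (P : Type) (_ : Finite P)
      (T : Transducer P (Option (Σ _ : PartrecToTM2.K', PartrecToTM2.Γ'))) (p₀ : P),
      ∀ n, T.Reproduces p₀ (inputQueue n) ↔ (c.eval [n]).Dom := by
  let M := PartrecToTM2.tr
  let l := PartrecToTM2.trNormal c .halt
  let L := PartrecToTM2.codeSupp c .halt
  have hL : @TM2.Supports _ _ _ _ ⟨l⟩ M L := PartrecToTM2.tr_supports c .halt
  let T := (StackMachine.transducer M).restrict _ (StackMachine.next_mem_support M hL.2)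
  have hl : .exec (M l) none ∈ StackMachine.support M L :=
    StackMachine.exec_mem_support (StackMachine.apply_mem_statements hL.1) none
  refine ⟨_, StackMachine.finite_support M L, T, ⟨_, hl⟩, fun n => ?_⟩
  have hinit : PartrecToTM2.init c [n] =
      ⟨some l, none, StackMachine.unshuffle ((PartrecToTM2.trList [n]).map (Sigma.mk .main))⟩ := by
    rw [StackMachine.unshuffle_map_mk, PartrecToTM2.init]
    congr 1
    funext k
    cases k <;> rfl
  calc T.Reproduces ⟨_, hl⟩ (inputQueue n)
      ↔ (StackMachine.transducer M).Reproduces (.exec (M l) none) (inputQueue n) := by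
        simp only [Transducer.Reproduces, T, Transducer.outputs_restrict]
    _ ↔ (eval (TM2.step M) (PartrecToTM2.init c [n])).Dom := by
        rw [hinit]
        exact StackMachine.reproduces_iff_dom M l none _
    _ ↔ (c.eval [n]).Dom := by
        rw [PartrecToTM2.tr_eval]
        rfl

theorem mainTheorem2 :
    ¬ DecidableProblem OneTurnPair.encode (fun I => I.M₁.language ⊓ I.M₂.language = ⊥) ∧
    ¬ DecidableProblem OneTurnPair.encode (fun I => I.M₁.language ≤ I.M₂.language) := by
  obtain ⟨c, hc⟩ := exists_code_not_computablePred_dom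
  obtain ⟨P, _, T, p₀, hT⟩ := exists_transducer_reproduces_iff_dom c
  have hencode (F : Finset (Transducer.Phase P)) :=
    (T.primrec_encode_matcherPair p₀ primrec_inputQueue F).to_comp
  constructor
  · intro h
    refine hc ((h.computablePred (hencode {.accepted})).not.of_eq fun n => ?_)
    rw [← hT, Transducer.matcherPair, OneTurnPair.disjoint_ofFinite_iff,
      Transducer.matcher_disjoint_iff, not_not]
  · intro h
    let F : Finset (Transducer.Phase P) := (Set.toFinite {q | q ≠ .accepted}).toFinset
    refine hc ((h.computablePred (hencode F)).not.of_eq fun n => ?_)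
    rw [← hT, Transducer.matcherPair, OneTurnPair.le_ofFinite_iff,
      Transducer.matcher_le_iff _ _ _ fun q => by simp [F], not_not]
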